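/- Let $n$ data points $x_1,\dots,x_n\in\mathbb{R}^p$ be given, exactly $m$ of which lie on a linear subspace $L\subset\mathbb{R}^p$ of dimension $d\ge 1$, and assume general position otherwise: every $q$-tuple of data points (points with distinct indices) with $q\le p$ is linearly independent unless it includes at least $d+1$ points from $L$. The Hardt–Moitra algorithm repeatedly draws, independently and uniformly at random, a $p$-tuple of data points (drawn without replacement within the tuple, i.e. one of the $\binom{n}{p}$ index sets of size $p$), and stops at the first tuple that is linearly dependent. Its number of iterations is the number of tuples drawn. Put $$\theta_2=\theta_2(n,p,m,d):=\sum_{k\ge d+1}\binom{m}{k}\binom{n-m}{p-k}\Big/\binom{n}{p}.$$ For every $\tau<1$ there are constants $c(\tau)>0$ and $C(\tau)<\infty$, depending only on $\tau$, such that for all integers $n,p,m,d$ with $d\ge 1$, $1\le p<n$, $0\le m\le n$ satisfying $$\frac mn\ge\frac dp,\qquad \frac dp\le\tau,\qquad \frac pn\le\tau,$$ we have $\theta_2\ge c(\tau)$, and for all data $x_1,\dots,x_n$ and $L$ as above with these parameters the expected number of iterations of the Hardt–Moitra algorithm is at most $C(\tau)$. -/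

import Mathlib

open scoped ENNReal NNReal

namespace HardtMoitra

/-- The number of data points `x i` that lie on the subspace `L` (the inliers),
counted by index. -/
noncomputable def numInliers {n p : ℕ} (x : Fin n → EuclideanSpace ℝ (Fin p))
    (L : Submodule ℝ (EuclideanSpace ℝ (Fin p))) : ℕ :=
  {i : Fin n | x i ∈ L}.ncard

/-- The data points are in general position apart from the points on `L`:
every `q`-tuple of data points with `q ≤ p` is linearly independent
unless it includes at least `dim L + 1` points from `L`. A tuple of data points is
given by the set `S` of its indices. -/
def InGeneralPosition {n p : ℕ} (x : Fin n → EuclideanSpace ℝ (Fin p))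
    (L : Submodule ℝ (EuclideanSpace ℝ (Fin p))) : Prop :=
  ∀ S : Finset (Fin n), S.card ≤ p →
    ¬ (Module.finrank ℝ L + 1 ≤ {i : Fin n | i ∈ S ∧ x i ∈ L}.ncard) →
      LinearIndepOn ℝ x (S : Set (Fin n))

/-- `θ₂ = ∑_{k ≥ d+1} C(m,k) C(n-m,p-k) / C(n,p)`. The terms with `k > p` vanish, so the sum
stops at `p` (and no truncated subtraction `p - k` occurs). -/
noncomputable def theta₂ (n p m d : ℕ) : ℝ :=
  (∑ k ∈ Finset.Icc (d + 1) p, (m.choose k : ℝ) * ((n - m).choose (p - k) : ℝ)) /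
    (n.choose p : ℝ)

/-- The index sets of tuples carry the discrete σ-algebra. -/
instance instMeasurableSpaceTuple (n : ℕ) : MeasurableSpace (Finset (Fin n)) := ⊤

/-- One random draw: a `p`-tuple of data points drawn uniformly at random (without replacement
inside the tuple), i.e. a uniformly random `p`-element set of indices. -/
noncomputable def draw (n p : ℕ) (h : p ≤ n) : PMF (Finset (Fin n)) :=
  PMF.uniformOfFinset (Finset.powersetCard p (Finset.univ : Finset (Fin n)))
    (Finset.powersetCard_nonempty.2 (by simpa using h))

/-- The law of an infinite sequence of independent uniformly random draws. -/
noncomputable def drawsMeasure (n p : ℕ) (h : p ≤ n) :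
    MeasureTheory.Measure (ℕ → Finset (Fin n)) :=
  MeasureTheory.Measure.infinitePi (fun _ : ℕ => (draw n p h).toMeasure)

/-- The number of iterations of the algorithm when the successive draws are `ω 0, ω 1, …`:
the algorithm stops at the first draw whose points are linearly dependent. It is `1` if the
first draw is linearly dependent and `⊤` if the algorithm never stops. -/
noncomputable def iterations {n p : ℕ} (x : Fin n → EuclideanSpace ℝ (Fin p))
    (ω : ℕ → Finset (Fin n)) : ℕ∞ :=
  ⨅ t ∈ {t : ℕ | ¬ LinearIndepOn ℝ x (ω t : Set (Fin n))}, ((t : ℕ∞) + 1)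

/-- The expected number of iterations of the algorithm on the data `x`. -/
noncomputable def expectedIterations {n p : ℕ} (h : p ≤ n)
    (x : Fin n → EuclideanSpace ℝ (Fin p)) : ℝ≥0∞ :=
  ∫⁻ ω, ((iterations x ω : ℕ∞) : ℝ≥0∞) ∂(drawsMeasure n p h)

end HardtMoitra

/-! A tuple with more than `d` inliers is dependent, so the waiting time is at most geometric with
mean `1/θ₂`. It remains to bound `θ₂`, the probability that a hypergeometric variable exceeds `d`,
where `d` is at most its mean. Compare both tails with the weight at `d`, via the ratio of
consecutive weights. The part up to `d` is at most of order `√d` times that weight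
(`lower_tail_le`). Just above `d` each ratio is at least `1 - O(s/d)`, so about `√d` further weights
keep half of it (`hypergeomWeight_window_ge`). Thus the two parts are comparable (`theta₂_ge`). -/

namespace HardtMoitra

/-! ### Hypergeometric weights and their consecutive ratios. -/

/-- The number of `p`-element subsets of an `n`-element set that meet a fixed `m`-element subset
in exactly `k` elements. -/
noncomputable def hypergeomWeight (n p m k : ℕ) : ℝ :=
  (m.choose k : ℝ) * ((n - m).choose (p - k) : ℝ)

lemma hypergeomWeight_nonneg (n p m k : ℕ) : 0 ≤ hypergeomWeight n p m k := by
  unfold hypergeomWeight; positivity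

lemma choose_succ_mul_cast (a b : ℕ) :
    (a.choose (b + 1) : ℝ) * (b + 1) = a.choose b * ((a : ℝ) - b) := by
  rcases le_or_gt b a with h | h
  · have := Nat.choose_succ_right_eq a b
    rw [← Nat.cast_sub h]
    exact_mod_cast this
  · rw [Nat.choose_eq_zero_of_lt h, Nat.choose_eq_zero_of_lt (by omega)]
    simp

/-- The ratio is kept cross-multiplied because the real factor `n - m - p + k + 1` can be zero or
negative. -/
lemma hypergeomWeight_succ_mul {n p m k : ℕ} (hm : m ≤ n) (hk : k < p) :
    hypergeomWeight n p m (k + 1) * ((k + 1) * ((n : ℝ) - m - p + k + 1)) =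
      hypergeomWeight n p m k * (((m : ℝ) - k) * ((p : ℝ) - k)) := by
  obtain ⟨b, rfl⟩ : ∃ b, p = k + 1 + b := ⟨p - k - 1, by omega⟩
  have h1 := choose_succ_mul_cast m k
  have h2 := choose_succ_mul_cast (n - m) b
  rw [Nat.cast_sub hm] at h2
  unfold hypergeomWeight
  rw [show k + 1 + b - (k + 1) = b by omega, show k + 1 + b - k = b + 1 by omega]
  push_cast
  linear_combination ((n - m).choose b : ℝ) * ((n : ℝ) - m - b) * h1 -
    (m.choose k : ℝ) * ((m : ℝ) - k) * h2

lemma hypergeomWeight_eq_zero {n p m k : ℕ} (hm : m ≤ n)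
    (h : (n : ℝ) - m - p + k + 1 ≤ 0) : hypergeomWeight n p m k = 0 := by
  have h' : n + k + 1 ≤ m + p := by
    have : ((n + k + 1 : ℕ) : ℝ) ≤ (m + p : ℕ) := by push_cast; linarith
    exact_mod_cast this
  unfold hypergeomWeight
  rw [Nat.choose_eq_zero_of_lt (show n - m < p - k by omega)]
  simp

/-! ### The lower tail. -/

/-- Below the mean the weights increase. -/
lemma mul_hypergeomWeight_le {n p m d k : ℕ} (hm : m ≤ n) (hpn : p ≤ n) (hdp : d < p)
    (hmean : (n : ℝ) * d ≤ m * p) (hk : k < d) :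
    d * hypergeomWeight n p m k ≤ (k + 1) * hypergeomWeight n p m (k + 1) := by
  have hid := hypergeomWeight_succ_mul (n := n) (p := p) hm (hk.trans hdp)
  have hw := hypergeomWeight_nonneg n p m (k + 1)
  have hkd : (k : ℝ) + 1 ≤ d := by exact_mod_cast hk
  have hdp' : (d : ℝ) + 1 ≤ p := by exact_mod_cast hdp
  have hpn' : (p : ℝ) ≤ n := by exact_mod_cast hpn
  have hk0 : (0 : ℝ) ≤ k := k.cast_nonneg
  have hd0 : (0 : ℝ) < d := by linarith
  have hp0 : (0 : ℝ) < p := by linarith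
  have hdm : (d : ℝ) ≤ m := by
    have : (d : ℝ) * p ≤ m * p := by nlinarith
    exact le_of_mul_le_mul_right this hp0
  have hpos : 0 < ((m : ℝ) - k) * ((p : ℝ) - k) := mul_pos (by linarith) (by linarith)
  -- The right side minus the left is `(mp - nd) + m(d-k) + (p-k)(d-k) - d`, and `m(d-k) ≥ d`
  -- absorbs the last term.
  have key : ((n : ℝ) - m - p + k + 1) * d ≤ ((m : ℝ) - k) * ((p : ℝ) - k) := by
    have h1 : (d : ℝ) * (d - k) ≤ m * p + m * (d - k) - n * d := by
      nlinarith [mul_le_mul_of_nonneg_right hdm (show (0 : ℝ) ≤ d - k by linarith)]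
    nlinarith [mul_nonneg (show (0 : ℝ) ≤ p - d by linarith) (show (0 : ℝ) ≤ d - k by linarith),
      sq_nonneg ((d : ℝ) - k)]
  refine le_of_mul_le_mul_right ?_ hpos
  calc (d : ℝ) * hypergeomWeight n p m k * (((m : ℝ) - k) * ((p : ℝ) - k))
      = (k + 1) * hypergeomWeight n p m (k + 1) * (((n : ℝ) - m - p + k + 1) * d) := by
        linear_combination -(d : ℝ) * hid
    _ ≤ _ := mul_le_mul_of_nonneg_left key (by positivity)

lemma hypergeomWeight_mono {n p m d k : ℕ} (hm : m ≤ n) (hpn : p ≤ n) (hdp : d < p)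
    (hmean : (n : ℝ) * d ≤ m * p) {l : ℕ} (hkl : k ≤ l) (hl : l ≤ d) :
    hypergeomWeight n p m k ≤ hypergeomWeight n p m l := by
  induction l, hkl using Nat.le_induction with
  | base => exact le_rfl
  | succ l hkl ih =>
    refine (ih (by omega)).trans ?_
    have h := mul_hypergeomWeight_le hm hpn hdp hmean (show l < d by omega)
    have hld : (l : ℝ) + 1 ≤ d := by exact_mod_cast hl
    have hd0 : (0 : ℝ) < d := by have : (0 : ℝ) ≤ l := l.cast_nonneg
                                 linarith
    have hw := hypergeomWeight_nonneg n p m (l + 1)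
    exact le_of_mul_le_mul_left (h.trans (mul_le_mul_of_nonneg_right hld hw)) hd0

/-- At distance `s` below `d` the weights grow at least geometrically. The induction closes because
`d * w j ≤ (j+1) * w (j+1)` and `j + 1 + s ≤ d`. -/
lemma sum_hypergeomWeight_le {n p m d s : ℕ} (hm : m ≤ n) (hpn : p ≤ n) (hdp : d < p)
    (hmean : (n : ℝ) * d ≤ m * p) (hs : 1 ≤ s) (hsd : s ≤ d) {j : ℕ} (hj : j + s ≤ d) :
    s * ∑ k ∈ Finset.range (j + 1), hypergeomWeight n p m k ≤
      d * hypergeomWeight n p m j := by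
  induction j with
  | zero =>
    simpa using mul_le_mul_of_nonneg_right (show (s : ℝ) ≤ d by exact_mod_cast hsd)
      (hypergeomWeight_nonneg n p m 0)
  | succ j ih =>
    rw [Finset.sum_range_succ, mul_add]
    have h := mul_hypergeomWeight_le hm hpn hdp hmean (show j < d by omega)
    have hjs : (j : ℝ) + 1 + s ≤ d := by exact_mod_cast hj
    nlinarith [ih (by omega), hypergeomWeight_nonneg n p m (j + 1)]

/-- The lower tail of the hypergeometric weights. -/
lemma lower_tail_le {n p m d s : ℕ} (hm : m ≤ n) (hpn : p ≤ n) (hdp : d < p)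
    (hmean : (n : ℝ) * d ≤ m * p) (hs : 1 ≤ s) (hsd : s ≤ d) :
    s * ∑ k ∈ Finset.range (d + 1), hypergeomWeight n p m k ≤
      (d + s * s) * hypergeomWeight n p m d := by
  obtain ⟨e, rfl⟩ : ∃ e, d = e + s := ⟨d - s, by omega⟩
  -- The geometric bound serves up to `d - s`; each of the last `s` weights is at most the one at
  -- `d`.
  have h1 := sum_hypergeomWeight_le hm hpn hdp hmean hs hsd le_rfl
  have h2 := hypergeomWeight_mono hm hpn hdp hmean (show e ≤ e + s by omega) le_rfl
  have h3 : ∑ k ∈ Finset.range s, hypergeomWeight n p m (e + 1 + k) ≤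
      s * hypergeomWeight n p m (e + s) := by
    have := Finset.sum_le_card_nsmul (Finset.range s)
      (fun k => hypergeomWeight n p m (e + 1 + k)) (hypergeomWeight n p m (e + s))
      (fun k hk => hypergeomWeight_mono hm hpn hdp hmean
        (by have := Finset.mem_range.1 hk; omega) le_rfl)
    simpa using this
  rw [show e + s + 1 = e + 1 + s by omega, Finset.sum_range_add, mul_add, add_mul]
  have hs0 : (0 : ℝ) ≤ s := s.cast_nonneg
  refine add_le_add (h1.trans (mul_le_mul_of_nonneg_left h2 (Nat.cast_nonneg _))) ?_
  rw [mul_assoc]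
  exact mul_le_mul_of_nonneg_left h3 hs0

/-! ### Weights just above `d`. -/

lemma mul_hypergeomWeight_le_succ {n p m k : ℕ} (hm : m ≤ n) (hk : k < p) {r : ℝ}
    (h : r * ((k + 1) * ((n : ℝ) - m - p + k + 1)) ≤ ((m : ℝ) - k) * ((p : ℝ) - k)) :
    r * hypergeomWeight n p m k ≤ hypergeomWeight n p m (k + 1) := by
  rcases le_or_gt ((n : ℝ) - m - p + k + 1) 0 with h0 | h0
  · rw [hypergeomWeight_eq_zero hm h0, mul_zero]
    exact hypergeomWeight_nonneg ..
  · have hpos : 0 < ((k : ℝ) + 1) * ((n : ℝ) - m - p + k + 1) := by positivity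
    refine le_of_mul_le_mul_right ?_ hpos
    rw [hypergeomWeight_succ_mul hm hk]
    calc _ = hypergeomWeight n p m k * (r * ((k + 1) * ((n : ℝ) - m - p + k + 1))) := by ring
      _ ≤ _ := mul_le_mul_of_nonneg_left h (hypergeomWeight_nonneg ..)

/-- Serves small `d`, where the window above `d` shrinks to one step. The 2 comes from `d + 1 ≤ 2d`,
the `1 + κ` from the `+1` in the other denominator factor. -/
lemma hypergeomWeight_succ_mean_ge {n p m d : ℕ} {κ : ℝ} (hm : m ≤ n) (hpn : p < n)
    (hdp : d < p) (hd : 1 ≤ d) (hmean : (n : ℝ) * d ≤ m * p)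
    (hκn : (n : ℝ) ≤ κ * (n - p)) :
    (2 * (1 + κ))⁻¹ * hypergeomWeight n p m d ≤ hypergeomWeight n p m (d + 1) := by
  have hpn' : (p : ℝ) + 1 ≤ n := by exact_mod_cast hpn
  have hdp' : (d : ℝ) + 1 ≤ p := by exact_mod_cast hdp
  have hd1 : (1 : ℝ) ≤ d := by exact_mod_cast hd
  have hp0 : (0 : ℝ) < p := by linarith
  have hκ : 0 < κ := by
    by_contra hneg
    nlinarith
  refine mul_hypergeomWeight_le_succ hm hdp ?_
  rw [inv_mul_le_iff₀ (by positivity)]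
  refine le_of_mul_le_mul_left ?_ hp0
  have hA : 0 < ((n : ℝ) - p) * (p - d) := mul_pos (by linarith) (by linarith)
  have e1 : (d : ℝ) * (n - p) ≤ p * (m - d) := by nlinarith
  have e2 : (p : ℝ) * (n - m - p + d + 1) ≤ (1 + κ) * (((n : ℝ) - p) * (p - d)) := by
    have : (p : ℝ) ≤ κ * (((n : ℝ) - p) * (p - d)) := by
      nlinarith [mul_nonneg (mul_nonneg hκ.le (show (0 : ℝ) ≤ n - p by linarith))
        (show (0 : ℝ) ≤ p - d - 1 by linarith)]
    nlinarith
  calc (p : ℝ) * ((d + 1) * (n - m - p + d + 1))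
      = (d + 1) * (p * (n - m - p + d + 1)) := by ring
    _ ≤ (d + 1) * ((1 + κ) * (((n : ℝ) - p) * (p - d))) :=
        mul_le_mul_of_nonneg_left e2 (by positivity)
    _ ≤ (2 * d) * ((1 + κ) * (((n : ℝ) - p) * (p - d))) :=
        mul_le_mul_of_nonneg_right (by linarith) (by positivity)
    _ = 2 * (1 + κ) * ((d * (n - p)) * (p - d)) := by ring
    _ ≤ 2 * (1 + κ) * ((p * (m - d)) * (p - d)) := by
        refine mul_le_mul_of_nonneg_left ?_ (by positivity)
        exact mul_le_mul_of_nonneg_right e1 (by linarith)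
    _ = _ := by ring

/-- The first-order terms in `u` cancel, since `(1+κ)² = 1 + 2κ + κ²`; smallness of `u` controls the
rest. -/
lemma one_sub_mul_mul_le {κ u : ℝ} (hκ : 0 ≤ κ) (hu : 0 ≤ u) (h : (1 + κ) ^ 2 * u ≤ 1) :
    (1 - (1 + κ) ^ 2 * u) * ((1 + u) * (1 + κ ^ 2 * u)) ≤ (1 - κ * u) * (1 - κ * u) := by
  have hku : 0 ≤ κ * u := by positivity
  have hkku : 0 ≤ κ ^ 2 * u := by positivity
  have h1 : u + 2 * (κ * u) + κ ^ 2 * u ≤ 1 := by linarith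
  set a := κ * u
  set b := κ ^ 2 * u
  have e : (1 + κ) ^ 2 * u = u + 2 * a + b := by simp only [a, b]; ring
  rw [e]
  have hub : 0 ≤ u * b := by positivity
  have := mul_nonneg hub (show 0 ≤ u + 2 * a + b by positivity)
  nlinarith [mul_nonneg hku hu, mul_nonneg hku hkku, sq_nonneg a, sq_nonneg u, sq_nonneg b]

/-- Slightly above the mean the weights decrease slowly. -/
lemma hypergeomWeight_succ_ge {n p m d s i : ℕ} {κ : ℝ} (hm : m ≤ n) (hpn : p < n)
    (hdp : d < p) (hd : 1 ≤ d) (hmean : (n : ℝ) * d ≤ m * p)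
    (hκn : (n : ℝ) ≤ κ * (n - p)) (hκp : (p : ℝ) ≤ κ * (p - d)) (hi : i < s)
    (hs : (1 + κ) ^ 2 * (s / d) ≤ 1 / 2) :
    (1 - (1 + κ) ^ 2 * (s / d)) * hypergeomWeight n p m (d + i) ≤
      hypergeomWeight n p m (d + i + 1) := by
  have hpn' : (p : ℝ) + 1 ≤ n := by exact_mod_cast hpn
  have hdp' : (d : ℝ) + 1 ≤ p := by exact_mod_cast hdp
  have hd1 : (1 : ℝ) ≤ d := by exact_mod_cast hd
  have hd0 : (0 : ℝ) < d := by linarith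
  have hp0 : (0 : ℝ) < p := by linarith
  have hi' : (i : ℝ) + 1 ≤ s := by exact_mod_cast hi
  have hi0 : (0 : ℝ) ≤ i := i.cast_nonneg
  have hκ : 0 < κ := by
    by_contra hneg
    nlinarith
  set u : ℝ := s / d with hu
  have hsu : (s : ℝ) = d * u := by rw [hu]; field_simp
  have hu0 : 0 < u := by
    have : (0 : ℝ) < s := by linarith
    positivity
  have hκu : κ * u ≤ 1 / 2 := by nlinarith [mul_nonneg (sq_nonneg κ) hu0.le, mul_pos hκ hu0]
  have hX : 0 < (n : ℝ) - p := by linarith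
  have hY : 0 < (p : ℝ) - d := by linarith
  -- `f1` to `f4` compare the four factors of the ratio with reference values whose quotient is 1;
  -- the relative errors are `κu`, `κu`, `u` and `κ²u`.
  have f1 : (d * (n - p)) * (1 - κ * u) ≤ p * ((m : ℝ) - (d + i)) := by
    have h1 : (p : ℝ) * i ≤ κ * (n - p) * (d * u) := by
      rw [← hsu]
      exact mul_le_mul (by linarith) (by linarith) hi0 (by positivity)
    nlinarith
  have f2 : ((p : ℝ) - d) * (1 - κ * u) ≤ p - (d + i) := by
    have : (d : ℝ) * u ≤ κ * (p - d) * u := mul_le_mul_of_nonneg_right (by linarith) hu0.le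
    nlinarith
  have f3 : (d : ℝ) + i + 1 ≤ d * (1 + u) := by nlinarith
  have f4 : (p : ℝ) * (n - m - p + (d + i) + 1) ≤
      (((n : ℝ) - p) * (p - d)) * (1 + κ ^ 2 * u) := by
    have h1 : (p : ℝ) * d ≤ κ * (p - d) * (κ * (n - p)) :=
      mul_le_mul hκp (by linarith) hd0.le (by positivity)
    have h2 : (p : ℝ) * (i + 1) ≤ p * (d * u) :=
      mul_le_mul_of_nonneg_left (by linarith) hp0.le
    have h3 := mul_le_mul_of_nonneg_right h1 hu0.le
    nlinarith
  have hk : d + i < p := by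
    have : (0 : ℝ) < p - (d + i) := lt_of_lt_of_le (mul_pos hY (by linarith)) f2
    have : ((d + i : ℕ) : ℝ) < p := by push_cast; linarith
    exact_mod_cast this
  refine mul_hypergeomWeight_le_succ hm hk ?_
  refine le_of_mul_le_mul_left ?_ hp0
  push_cast
  have hr : 0 ≤ 1 - (1 + κ) ^ 2 * u := by linarith
  calc (p : ℝ) * ((1 - (1 + κ) ^ 2 * u) * (((d : ℝ) + i + 1) * (n - m - p + (d + i) + 1)))
      = (1 - (1 + κ) ^ 2 * u) * (((d : ℝ) + i + 1) * (p * (n - m - p + (d + i) + 1))) := by ring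
    _ ≤ (1 - (1 + κ) ^ 2 * u) * (((d : ℝ) + i + 1) *
          ((((n : ℝ) - p) * (p - d)) * (1 + κ ^ 2 * u))) := by gcongr
    _ ≤ (1 - (1 + κ) ^ 2 * u) * ((d * (1 + u)) *
          ((((n : ℝ) - p) * (p - d)) * (1 + κ ^ 2 * u))) := by gcongr
    _ = d * (((n : ℝ) - p) * (p - d)) *
          ((1 - (1 + κ) ^ 2 * u) * ((1 + u) * (1 + κ ^ 2 * u))) := by ring
    _ ≤ d * (((n : ℝ) - p) * (p - d)) * ((1 - κ * u) * (1 - κ * u)) :=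
        mul_le_mul_of_nonneg_left (one_sub_mul_mul_le hκ.le hu0.le (by linarith))
          (by positivity)
    _ = ((d * (n - p)) * (1 - κ * u)) * (((p : ℝ) - d) * (1 - κ * u)) := by ring
    _ ≤ (p * ((m : ℝ) - (d + i))) * (p - (d + i)) := by
        have h0 : 0 ≤ 1 - κ * u := by linarith
        have h1 : 0 ≤ (d * ((n : ℝ) - p)) * (1 - κ * u) := by positivity
        exact mul_le_mul f1 f2 (by positivity) (h1.trans f1)
    _ = _ := by ring

/-- Bernoulli's inequality: `j ≤ s` steps, each losing a factor `1 - x`, leave at least `1 - jx ≥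
1/2`. -/
lemma hypergeomWeight_window_ge {n p m d s i : ℕ} {κ : ℝ} (hm : m ≤ n) (hpn : p < n)
    (hdp : d < p) (hd : 1 ≤ d) (hmean : (n : ℝ) * d ≤ m * p)
    (hκn : (n : ℝ) ≤ κ * (n - p)) (hκp : (p : ℝ) ≤ κ * (p - d)) (hi : i ≤ s)
    (hs1 : 1 ≤ s) (hs : 2 * (1 + κ) ^ 2 * s ^ 2 ≤ d) :
    hypergeomWeight n p m d / 2 ≤ hypergeomWeight n p m (d + i) := by
  have hs1' : (1 : ℝ) ≤ s := by exact_mod_cast hs1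
  have hd0 : (0 : ℝ) < d := by exact_mod_cast hd
  set x : ℝ := (1 + κ) ^ 2 * (s / d) with hx
  have hx0 : 0 ≤ x := by positivity
  have hsx : s * x ≤ 1 / 2 := by
    rw [hx, show (s : ℝ) * ((1 + κ) ^ 2 * (s / d)) = ((1 + κ) ^ 2 * s ^ 2) / d by ring,
      div_le_iff₀ hd0]
    linarith
  have hx2 : x ≤ 1 / 2 := by nlinarith
  have hw := hypergeomWeight_nonneg n p m d
  have key : ∀ j ≤ s, (1 - j * x) * hypergeomWeight n p m d ≤ hypergeomWeight n p m (d + j) := by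
    intro j
    induction j with
    | zero => intro _; simp
    | succ j ih =>
      intro hj
      have h := hypergeomWeight_succ_ge hm hpn hdp hd hmean hκn hκp
        (show j < s by omega) hx2
      have h2 := mul_le_mul_of_nonneg_left (ih (by omega)) (show 0 ≤ 1 - x by linarith)
      refine le_trans ?_ h
      refine le_trans ?_ h2
      have : (0 : ℝ) ≤ j * x * x := by positivity
      push_cast
      nlinarith
  refine le_trans ?_ (key i hi)
  have : (i : ℝ) * x ≤ s * x := mul_le_mul_of_nonneg_right (by exact_mod_cast hi) hx0
  nlinarith

/-! ### Comparison of the two tails. -/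

lemma sum_Icc_hypergeomWeight_ge {n p m d s : ℕ} {r : ℝ}
    (h : ∀ i, 1 ≤ i → i ≤ s → r ≤ hypergeomWeight n p m (d + i)) (hs : d + s ≤ p) :
    s * r ≤ ∑ k ∈ Finset.Icc (d + 1) p, hypergeomWeight n p m k := by
  calc (s : ℝ) * r = ∑ _k ∈ Finset.Icc (d + 1) (d + s), r := by simp
    _ ≤ ∑ k ∈ Finset.Icc (d + 1) (d + s), hypergeomWeight n p m k := by
        refine Finset.sum_le_sum fun k hk => ?_
        rw [Finset.mem_Icc] at hk
        have := h (k - d) (by omega) (by omega)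
        rwa [show d + (k - d) = k by omega] at this
    _ ≤ _ := Finset.sum_le_sum_of_subset_of_nonneg
        (Finset.Icc_subset_Icc le_rfl hs) fun _ _ _ => hypergeomWeight_nonneg ..

lemma sum_hypergeomWeight {n p m : ℕ} (hm : m ≤ n) :
    ∑ k ∈ Finset.range (p + 1), hypergeomWeight n p m k = n.choose p := by
  have h := Nat.add_choose_eq m (n - m) p
  rw [Nat.add_sub_cancel' hm, Finset.Nat.sum_antidiagonal_eq_sum_range_succ_mk] at h
  rw [h]
  push_cast
  rfl

/-- The probability that a hypergeometric variable exceeds its mean is bounded below. -/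
lemma theta₂_ge {n p m d N : ℕ} {κ : ℝ} (hm : m ≤ n) (hpn : p < n)
    (hdp : d < p) (hd : 1 ≤ d) (hmean : (n : ℝ) * d ≤ m * p)
    (hκ : 0 < κ) (hκn : (n : ℝ) ≤ κ * (n - p)) (hκp : (p : ℝ) ≤ κ * (p - d))
    (hN : 3 * (1 + κ) ≤ N) :
    (1 + (N ^ 2 + 1) * (2 * (1 + κ)))⁻¹ ≤ theta₂ n p m d := by
  have hN3 : (3 : ℝ) ≤ N := by linarith
  have hN0 : 0 < N := by
    have : (0 : ℝ) < N := by linarith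
    exact_mod_cast this
  set c₀ : ℝ := (2 * (1 + κ))⁻¹ with hc₀
  have hc₀0 : 0 < c₀ := by positivity
  have hc₀2 : c₀ ≤ 1 / 2 := by
    rw [hc₀, one_div]
    exact inv_anti₀ (by norm_num) (by linarith)
  -- Large enough that `d ≤ N²s²`, yet for `s ≥ 2` also `s²N² ≤ 4d`, whence `N ≥ 3(1+κ)` gives the
  -- window condition `2(1+κ)²s² ≤ d`.
  set s : ℕ := Nat.sqrt d / N + 1 with hs
  have hs1 : 1 ≤ s := Nat.le_add_left 1 _
  have hdN : (d : ℝ) ≤ N ^ 2 * s ^ 2 := by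
    have h1 : Nat.sqrt d < N * s := by
      rw [hs, mul_comm]
      exact Nat.lt_mul_of_div_lt (Nat.lt_succ_self _) hN0
    have h2 : d < (Nat.sqrt d + 1) * (Nat.sqrt d + 1) := Nat.lt_succ_sqrt d
    have h3 : d ≤ (N * s) * (N * s) := h2.le.trans (Nat.mul_le_mul h1 h1)
    have : (d : ℝ) ≤ (N * s) * (N * s) := by exact_mod_cast h3
    linarith
  have hw := hypergeomWeight_nonneg n p m d
  have hwin : s ≤ d ∧ d + s ≤ p ∧
      ∀ i, 1 ≤ i → i ≤ s → c₀ * hypergeomWeight n p m d ≤ hypergeomWeight n p m (d + i) := by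
    rcases Nat.lt_or_ge s 2 with hs2 | hs2
    · have : s = 1 := by omega
      rw [this]
      refine ⟨hd, hdp, fun i h1 h2 => ?_⟩
      obtain rfl : i = 1 := by omega
      exact hypergeomWeight_succ_mean_ge hm hpn hdp hd hmean hκn
    · have hsN : s * N ≤ 2 * Nat.sqrt d := by
        have h1 : (s - 1) * N ≤ Nat.sqrt d := by
          rw [hs, Nat.add_sub_cancel]
          exact Nat.div_mul_le_self _ _
        have h2 : s * N ≤ 2 * (s - 1) * N := Nat.mul_le_mul_right _ (by omega)
        nlinarith
      have hsd4 : (s : ℝ) ^ 2 * N ^ 2 ≤ 4 * d := by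
        have h1 : (s * N) * (s * N) ≤ (2 * Nat.sqrt d) * (2 * Nat.sqrt d) :=
          Nat.mul_le_mul hsN hsN
        have h2 := Nat.sqrt_le d
        have h3 : (s * N) * (s * N) ≤ 4 * d := by nlinarith
        have : ((s : ℝ) * N) * (s * N) ≤ 4 * d := by exact_mod_cast h3
        nlinarith
      have hs2' : (2 : ℝ) ≤ s := by exact_mod_cast hs2
      have hN2 : 9 * (1 + κ) ^ 2 ≤ (N : ℝ) ^ 2 := by nlinarith
      have hsκ : 2 * (1 + κ) ^ 2 * (s : ℝ) ^ 2 ≤ d := by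
        nlinarith [mul_le_mul_of_nonneg_left hN2 (sq_nonneg (s : ℝ)),
          sq_nonneg ((s : ℝ) * (1 + κ))]
      have hd0 : (0 : ℝ) < d := by exact_mod_cast hd
      have hκ1 : (1 + κ) ≤ (1 + κ) ^ 2 := by nlinarith
      have hss : (1 + κ) * s ≤ d := by nlinarith
      have hsd : (s : ℝ) ≤ d := by nlinarith
      have hdps : (d : ℝ) + s ≤ p := by
        have h1 : κ * (s : ℝ) ≤ κ * (p - d) := by
          have : (d : ℝ) ≤ p := by exact_mod_cast hdp.le
          nlinarith
        have := le_of_mul_le_mul_left h1 hκ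
        linarith
      refine ⟨by exact_mod_cast hsd, by exact_mod_cast hdps, fun i _ h2 => ?_⟩
      refine le_trans ?_ (hypergeomWeight_window_ge hm hpn hdp hd hmean hκn hκp h2 hs1 hsκ)
      nlinarith
  obtain ⟨hsd, hsp, hwin⟩ := hwin
  have hU := sum_Icc_hypergeomWeight_ge hwin hsp
  have hD := lower_tail_le hm hpn.le hdp hmean hs1 hsd
  set U := ∑ k ∈ Finset.Icc (d + 1) p, hypergeomWeight n p m k with hUdef
  set D := ∑ k ∈ Finset.range (d + 1), hypergeomWeight n p m k with hDdef
  have hDU : D + U = n.choose p := by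
    rw [← sum_hypergeomWeight hm, hUdef, hDdef, ← Finset.sum_range_add_sum_Ico _
      (show d + 1 ≤ p + 1 by omega)]
    rfl
  have hs0 : (0 : ℝ) < s := by exact_mod_cast hs1
  have hDle : D ≤ (N ^ 2 + 1) * (2 * (1 + κ)) * U := by
    have h1 : D ≤ (N ^ 2 + 1) * (s * hypergeomWeight n p m d) := by
      refine le_of_mul_le_mul_left (hD.trans ?_) hs0
      nlinarith
    have h2 : s * hypergeomWeight n p m d ≤ (2 * (1 + κ)) * U := by
      have := mul_le_mul_of_nonneg_left hU (show 0 ≤ 2 * (1 + κ) by positivity)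
      refine le_trans (le_of_eq ?_) this
      rw [hc₀]
      field_simp
    calc D ≤ _ := h1
      _ ≤ (N ^ 2 + 1) * ((2 * (1 + κ)) * U) := mul_le_mul_of_nonneg_left h2 (by positivity)
      _ = _ := by ring
  have hch : (0 : ℝ) < n.choose p := by exact_mod_cast Nat.choose_pos hpn.le
  change _ ≤ U / (n.choose p : ℝ)
  rw [le_div_iff₀ hch, inv_mul_le_iff₀ (by positivity), ← hDU]
  linarith

/-! ### Counting dependent tuples. -/

/-- A tuple containing more than `dim L` points of `L` is linearly dependent. -/
lemma not_linearIndepOn_of_finrank_lt {n p : ℕ} {x : Fin n → EuclideanSpace ℝ (Fin p)}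
    {L : Submodule ℝ (EuclideanSpace ℝ (Fin p))} {T : Finset (Fin n)} {S : Set (Fin n)}
    (hTS : (T : Set (Fin n)) ⊆ S) (hTL : ∀ i ∈ T, x i ∈ L) (hT : Module.finrank ℝ L < T.card) :
    ¬ LinearIndepOn ℝ x S := by
  intro h
  have h' : LinearIndependent ℝ (fun i : T => x i) := h.mono hTS
  have h2 : LinearIndependent ℝ (fun i : T => (⟨x i, hTL i i.2⟩ : L)) := by
    refine LinearIndependent.of_comp L.subtype ?_
    exact h'
  have := h2.fintype_card_le_finrank
  rw [Fintype.card_coe] at this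
  omega

-- Index sets are assembled from an inlier part and an outlier part; both parts can be read off from
-- the union, so nothing is counted twice.
open Classical in
lemma sum_choose_mul_choose_le {n p : ℕ} {x : Fin n → EuclideanSpace ℝ (Fin p)}
    {L : Submodule ℝ (EuclideanSpace ℝ (Fin p))} :
    ∑ k ∈ Finset.Icc (Module.finrank ℝ L + 1) p,
        (numInliers x L).choose k * (n - numInliers x L).choose (p - k) ≤
      ((Finset.powersetCard p (Finset.univ : Finset (Fin n))).filter
        (fun S : Finset (Fin n) => ¬ LinearIndepOn ℝ x (S : Set (Fin n)))).card := by
  set I : Finset (Fin n) := Finset.univ.filter (fun i => x i ∈ L) with hI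
  have hIc : I.card = numInliers x L := by
    rw [numInliers, ← Set.ncard_coe_finset]
    congr 1
    ext i
    simp [hI]
  have hIc' : (Iᶜ).card = n - numInliers x L := by
    rw [Finset.card_compl, Fintype.card_fin, hIc]
  rw [← hIc', ← hIc]
  have hcard : ∑ k ∈ Finset.Icc (Module.finrank ℝ L + 1) p,
        I.card.choose k * (Iᶜ).card.choose (p - k) =
      ((Finset.Icc (Module.finrank ℝ L + 1) p).sigma fun k =>
        Finset.powersetCard k I ×ˢ Finset.powersetCard (p - k) Iᶜ).card := by
    simp [Finset.card_sigma]
  rw [hcard]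
  refine Finset.card_le_card_of_injOn (fun a => a.2.1 ∪ a.2.2) ?_ ?_
  · rintro ⟨k, S, T⟩ ha
    simp only [Finset.coe_sigma, Set.mem_sigma_iff, Finset.mem_coe, Finset.mem_Icc,
      Finset.mem_product, Finset.mem_powersetCard] at ha
    obtain ⟨⟨hk1, hk2⟩, ⟨hSI, hS⟩, hTI, hT⟩ := ha
    have hdisj : Disjoint S T :=
      Finset.disjoint_of_subset_left hSI
        (Finset.disjoint_of_subset_right hTI disjoint_compl_right)
    simp only [Finset.coe_filter, Set.mem_ofPred_eq, Finset.mem_powersetCard]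
    refine ⟨⟨Finset.subset_univ _, ?_⟩, ?_⟩
    · rw [Finset.card_union_of_disjoint hdisj]
      omega
    · refine not_linearIndepOn_of_finrank_lt (L := L) (T := S) ?_ ?_ (by omega)
      · exact_mod_cast Finset.subset_union_left
      · intro i hi
        simpa [hI] using hSI hi
  · rintro ⟨k, S, T⟩ ha ⟨k', S', T'⟩ ha' heq
    simp only [Finset.coe_sigma, Set.mem_sigma_iff, Finset.mem_coe, Finset.mem_Icc,
      Finset.mem_product, Finset.mem_powersetCard] at ha ha' heq
    obtain ⟨-, ⟨hSI, hS⟩, hTI, hT⟩ := ha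
    obtain ⟨-, ⟨hSI', hS'⟩, hTI', hT'⟩ := ha'
    have hSS : S = S' := by
      ext i
      have h1 := @hSI i
      have h2 := @hTI i
      have h3 := @hSI' i
      have h4 := @hTI' i
      have h5 := Finset.ext_iff.1 heq i
      simp only [Finset.mem_union, Finset.mem_compl] at h2 h4 h5
      tauto
    have hTT : T = T' := by
      ext i
      have h1 := @hSI i
      have h2 := @hTI i
      have h3 := @hSI' i
      have h4 := @hTI' i
      have h5 := Finset.ext_iff.1 heq i
      simp only [Finset.mem_union, Finset.mem_compl] at h2 h4 h5
      tauto
    subst hSS hTT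
    obtain rfl : k = k' := by omega
    rfl

/-! ### Expected waiting time. -/

open MeasureTheory

/-- One draw is linearly dependent with probability at least `θ₂`. -/
lemma ofReal_theta₂_le {n p : ℕ} (h : p ≤ n) (x : Fin n → EuclideanSpace ℝ (Fin p))
    (L : Submodule ℝ (EuclideanSpace ℝ (Fin p))) :
    ENNReal.ofReal (theta₂ n p (numInliers x L) (Module.finrank ℝ L)) ≤
      (draw n p h).toMeasure {S | ¬ LinearIndepOn ℝ x (S : Set (Fin n))} := by
  classical
  rw [draw, PMF.toMeasure_uniformOfFinset_apply (ht := MeasurableSpace.measurableSet_top),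
    Finset.card_powersetCard, Finset.card_univ, Fintype.card_fin, theta₂,
    ENNReal.ofReal_div_of_pos (by exact_mod_cast Nat.choose_pos h), ENNReal.ofReal_natCast]
  refine ENNReal.div_le_div_right ?_ _
  have := sum_choose_mul_choose_le (x := x) (L := L)
  rw [← ENNReal.ofReal_natCast]
  refine ENNReal.ofReal_le_ofReal ?_
  simp only [Set.mem_ofPred_eq]
  exact_mod_cast this

/-- Tail-sum formula: the `t`-th term says that the first `t` draws are all independent. The term `t
= 0` is always 1, matching the `+1` in `iterations`; if no draw is dependent the sum is `⊤`. -/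
lemma iterations_le_tsum {n p : ℕ} (x : Fin n → EuclideanSpace ℝ (Fin p))
    (ω : ℕ → Finset (Fin n)) :
    ((iterations x ω : ℕ∞) : ℝ≥0∞) ≤
      ∑' t : ℕ, (Set.pi (Finset.range t : Set ℕ)
        (fun _ => {S : Finset (Fin n) | LinearIndepOn ℝ x (S : Set (Fin n))})).indicator
          (fun _ => (1 : ℝ≥0∞)) ω := by
  classical
  by_cases hex : ∃ t, ¬ LinearIndepOn ℝ x (ω t : Set (Fin n))
  · have hle : iterations x ω ≤ ((Nat.find hex + 1 : ℕ) : ℕ∞) := by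
      refine (iInf₂_le (Nat.find hex) (Nat.find_spec hex)).trans ?_
      push_cast
      exact le_rfl
    calc ((iterations x ω : ℕ∞) : ℝ≥0∞) ≤ (((Nat.find hex + 1 : ℕ) : ℕ∞) : ℝ≥0∞) := by
          exact_mod_cast hle
      _ = ∑ _t ∈ Finset.range (Nat.find hex + 1), (1 : ℝ≥0∞) := by simp
      _ ≤ ∑ t ∈ Finset.range (Nat.find hex + 1), (Set.pi (Finset.range t : Set ℕ)
            (fun _ => {S : Finset (Fin n) | LinearIndepOn ℝ x (S : Set (Fin n))})).indicator
              (fun _ => (1 : ℝ≥0∞)) ω := by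
          refine Finset.sum_le_sum fun t ht => ?_
          rw [Set.indicator_of_mem]
          intro j hj
          have hj' : j < Nat.find hex := by
            have h1 := Finset.mem_range.1 (Finset.mem_coe.1 hj)
            have h2 := Finset.mem_range.1 ht
            omega
          exact not_not.1 (Nat.find_min hex hj')
      _ ≤ _ := ENNReal.sum_le_tsum _
  · push Not at hex
    have : ∀ t : ℕ, (Set.pi (Finset.range t : Set ℕ)
        (fun _ => {S : Finset (Fin n) | LinearIndepOn ℝ x (S : Set (Fin n))})).indicator
          (fun _ => (1 : ℝ≥0∞)) ω = 1 := fun t =>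
      Set.indicator_of_mem (Set.mem_pi.2 fun j _ => hex j) _
    simp only [this]
    rw [ENNReal.tsum_const_eq_top_of_ne_zero one_ne_zero]
    exact le_top

/-- The expected number of iterations is at most the inverse of the probability of stopping. -/
lemma expectedIterations_le {n p : ℕ} (h : p ≤ n) (x : Fin n → EuclideanSpace ℝ (Fin p)) :
    expectedIterations h x ≤
      ((draw n p h).toMeasure {S | ¬ LinearIndepOn ℝ x (S : Set (Fin n))})⁻¹ := by
  set A : Set (Finset (Fin n)) := {S | LinearIndepOn ℝ x (S : Set (Fin n))} with hA
  have hAm : MeasurableSet A := MeasurableSpace.measurableSet_top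
  have hm : ∀ t : ℕ, MeasurableSet (Set.pi (Finset.range t : Set ℕ) fun _ => A) := fun t =>
    MeasurableSet.pi (Finset.range t).countable_toSet fun _ _ => hAm
  calc expectedIterations h x
      ≤ ∫⁻ ω, ∑' t : ℕ, (Set.pi (Finset.range t : Set ℕ) (fun _ => A)).indicator
          (fun _ => (1 : ℝ≥0∞)) ω ∂(drawsMeasure n p h) :=
        lintegral_mono fun ω => iterations_le_tsum x ω
    _ = ∑' t : ℕ, drawsMeasure n p h (Set.pi (Finset.range t : Set ℕ) (fun _ => A)) := by
        rw [lintegral_tsum fun t => (measurable_const.indicator (hm t)).aemeasurable]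
        refine tsum_congr fun t => ?_
        rw [lintegral_indicator (hm t)]
        simp
    _ = ∑' t : ℕ, ((draw n p h).toMeasure A) ^ t := by
        refine tsum_congr fun t => ?_
        rw [drawsMeasure, Measure.infinitePi_pi _ fun _ _ => hAm]
        simp
    _ = (1 - (draw n p h).toMeasure A)⁻¹ := ENNReal.tsum_geometric _
    _ = _ := by
        rw [← prob_compl_eq_one_sub hAm]
        rfl

end HardtMoitra

/-! ### Choice of constants. -/

theorem mainTheorem4 (τ : ℝ) (hτ : τ < 1) :
    ∃ c : ℝ, 0 < c ∧ ∃ C : ℝ≥0,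
      ∀ (n p m d : ℕ) (hpn : p < n), 1 ≤ d → 1 ≤ p → m ≤ n →
        (d : ℝ) / (p : ℝ) ≤ (m : ℝ) / (n : ℝ) →
        (d : ℝ) / (p : ℝ) ≤ τ →
        (p : ℝ) / (n : ℝ) ≤ τ →
          c ≤ HardtMoitra.theta₂ n p m d ∧
          ∀ (x : Fin n → EuclideanSpace ℝ (Fin p))
            (L : Submodule ℝ (EuclideanSpace ℝ (Fin p))),
            Module.finrank ℝ L = d →
            HardtMoitra.numInliers x L = m →
            HardtMoitra.InGeneralPosition x L →
              HardtMoitra.expectedIterations hpn.le x ≤ (C : ℝ≥0∞) := by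
  have hδ : 0 < 1 - τ := by linarith
  -- With this `κ`, `d ≤ τp` and `p ≤ τn` become `p ≤ κ(p-d)` and `n ≤ κ(n-p)`.
  set κ : ℝ := (1 - τ)⁻¹ with hκdef
  have hκ : 0 < κ := by positivity
  obtain ⟨N, hN⟩ := exists_nat_ge (3 * (1 + κ))
  set c : ℝ := (1 + (N ^ 2 + 1) * (2 * (1 + κ)))⁻¹ with hc
  have hc0 : 0 < c := by positivity
  refine ⟨c, hc0, c.toNNReal⁻¹, fun n p m d hpn hd hp hm hdm hdp hpn' => ?_⟩
  have hp0 : (0 : ℝ) < p := by exact_mod_cast hp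
  have hn0 : (0 : ℝ) < n := by exact_mod_cast hp.trans hpn.le
  rw [div_le_iff₀ hp0] at hdp
  rw [div_le_iff₀ hn0] at hpn'
  rw [div_le_div_iff₀ hp0 hn0] at hdm
  have hdp' : d < p := by
    have : (d : ℝ) < p := by nlinarith
    exact_mod_cast this
  have hθ : c ≤ HardtMoitra.theta₂ n p m d := by
    refine HardtMoitra.theta₂_ge hm hpn hdp' hd (by linarith) hκ ?_ ?_ hN
    · rw [hκdef, le_inv_mul_iff₀ hδ]
      linarith
    · rw [hκdef, le_inv_mul_iff₀ hδ]
      linarith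
  refine ⟨hθ, fun x L hL hx _ => ?_⟩
  refine (HardtMoitra.expectedIterations_le hpn.le x).trans ?_
  rw [ENNReal.coe_inv (by simpa using hc0), ENNReal.inv_le_inv]
  refine le_trans ?_ (HardtMoitra.ofReal_theta₂_le hpn.le x L)
  rw [hL, hx]
  exact ENNReal.ofReal_le_ofReal hθ
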